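/- Let $n\in\mathbb N$, $T>0$, let $\Omega\subset\mathbb R^n$ and $\Lambda\subset\mathbb R$ be open, $f:\Lambda\times\Omega\times[0,T]\to\mathbb R^n$, $g:\Omega\times[0,T]\to\mathbb R^n$, and let $h:(-\infty,T]\to\mathbb R$ be left-continuous, of bounded variation on $[0,T]$, with $h(t)=h(0)$ for $t<0$. Let $\|y\|=\sum_i|y_i|$ on $\mathbb R^n$. Assume: (i) $f(\lambda,\cdot,t)$ is continuous on $\Omega$ for all $\lambda\in\Lambda$, $t\in[0,T]$; $f(\lambda,y,\cdot)$ is Lebesgue measurable on $[0,T]$ for all $(\lambda,y)\in\Lambda\times\Omega$; and there is a Lebesgue integrable $m:[0,T]\to[0,\infty)$ with $\|f(\lambda,y,t)\|\le m(t)$ on $\Lambda\times\Omega\times[0,T]$; (ii) $g(\cdot,t)$ is continuous on $\Omega$ for all $t\in[0,T]$, and there is $m_h:[0,T]\to[0,\infty)$ with $\|g(y,t)\|\le m_h(t)$ on $\Omega\times[0,T]$ for which the Kurzweil–Stieltjes integral $\int_0^T m_h(t)\,d[\mathrm{var}_0^t h]$ exists (and is finite). Integrals with respect to $dh$ and $ds$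 below are Kurzweil–Stieltjes integrals. Let $\mathcal D$ be the space of $C^\infty$ functions $\varphi:\mathbb R\to\mathbb R$ all of whose derivatives, including $\varphi$ itself, vanish outside $(0,T)$, where $\varphi_k\to\varphi$ means uniform convergence of all derivatives. The $n$-vector distributions are the continuous linear functionals on $\mathcal D^n$; a function $u\in L^1[0,T]$ is identified with $\varphi\mapsto\int_0^T u(t)\cdot\varphi(t)\,dt$, and $\langle Du,\varphi\rangle=-\langle u,\varphi'\rangle$. If $\int_0^T v\,dh$ exists, the product $v\,.\,Dh$ is defined as the distributional derivative of $t\mapsto\int_0^t v\,dh$. For $\lambda\in\Lambda$, a function $x:[0,T]\to\mathbb R^n$ *solves the measure differential equation* $Dx=f(\lambda,x,t)+g(x,t)\,.\,Dh$ if $x$ has bounded variation on $[0,T]$, is left-continuous on $(0,T]$, has values in $\Omega$, the product $g(x(\cdot),\cdot)\,.\,Dh$ has a sense, and $\langle Dx,\varphi\rangle=\langle f(\lambda,x(\cdot),\cdot),\varphi\rangle+\langle g(x(\cdot),\cdot)\,.\,Dh,\varphi\rangle$ for all $\varphi\in\mathcal D^n$. It *solves the Stieltjes integral equation* if it has values in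 $\Omega$ and, for all $t\in[0,T]$, the integrals exist and $$x(t)=x(0)+\int_0^t f(\lambda,x(s),s)\,ds+\int_0^t g(x(s),s)\,dh(s).$$ Then for every $\lambda\in\Lambda$ and every regulated $x:[0,T]\to\mathbb R^n$: (a) $x$ solves the Stieltjes integral equation if and only if $x$ solves the measure differential equation and satisfies, at the initial point, $x(0+)-x(0)=g(x(0),0)\,\big(h(0+)-h(0)\big)$; (b) if $x$ solves the measure differential equation (with no condition at $0$), then for all $0<s\le t\le T$ the integrals below exist and $x(t)=x(s)+\int_s^t f(\lambda,x(r),r)\,dr+\int_s^t g(x(r),r)\,dh(r)$. -/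

import Mathlib

open MeasureTheory Set Filter Topology
open scoped ContDiff

/-- `ℝⁿ`. Limits, bounded variation and Kurzweil integrals of `ℝⁿ`-valued functions do not depend
on the choice of the norm; where the norm `∑ i, |x i|` occurs in an estimate, it is `norm1`. -/
abbrev Vec (n : ℕ) : Type := Fin n → ℝ

/-- The norm `∑ i, |x i|` of `ℝⁿ`. -/
def norm1 {n : ℕ} (x : Vec n) : ℝ := ∑ i, |x i|

/-! ### Regulated functions

Functions on `[a, b]` are modelled by functions on `ℝ`, of which only the values on `[a, b]`
matter. -/

/-- `x` is regulated on `[a, b]`: the one-sided limits exist at the points of `(a, b]` and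
`[a, b)`. -/
def IsRegulatedOn {E : Type*} [TopologicalSpace E] (x : ℝ → E) (a b : ℝ) : Prop :=
  (∀ t ∈ Ioc a b, ∃ l, Tendsto x (𝓝[<] t) (𝓝 l)) ∧
    (∀ t ∈ Ico a b, ∃ l, Tendsto x (𝓝[>] t) (𝓝 l))

/-- `x` is left-continuous at every point of `S`. -/
def IsLeftContinuousOn {E : Type*} [TopologicalSpace E] (x : ℝ → E) (S : Set ℝ) : Prop :=
  ∀ t ∈ S, Tendsto x (𝓝[<] t) (𝓝 (x t))

/-- `Δ⁺x(t) = x(t+) - x(t)` exists and equals `d`. -/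
def HasRightJump {E : Type*} [NormedAddCommGroup E] (x : ℝ → E) (t : ℝ) (d : E) : Prop :=
  Tendsto (fun s => x s - x t) (𝓝[>] t) (𝓝 d)

/-! ### The Kurzweil and the Kurzweil–Stieltjes integral -/

/-- Tagged partitions of `[a, b]`: division points `a = t₀ ≤ t₁ ≤ ⋯ ≤ t_ν = b`, where
`t_j = pt j`, and tags `tag j ∈ [pt j, pt (j + 1)]` for `j < ν`. The values of `pt` and `tag` at
larger indices play no role. -/
structure TaggedDivision (a b : ℝ) where
  size : ℕ
  pt : ℕ → ℝ
  tag : ℕ → ℝ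
  pt_zero : pt 0 = a
  pt_size : pt size = b
  tag_mem : ∀ j < size, tag j ∈ Icc (pt j) (pt (j + 1))

/-- `[t_{j-1}, t_j] ⊆ (τ_j - δ(τ_j), τ_j + δ(τ_j))` for all `j`. -/
def TaggedDivision.IsFine {a b : ℝ} (P : TaggedDivision a b) (δ : ℝ → ℝ) : Prop :=
  ∀ j < P.size,
    Icc (P.pt j) (P.pt (j + 1)) ⊆ Ioo (P.tag j - δ (P.tag j)) (P.tag j + δ (P.tag j))

/-- The sum `∑ⱼ [U(τ_j, t_j) - U(τ_j, t_{j-1})]`. -/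
def TaggedDivision.kurzweilSum {a b : ℝ} {E : Type*} [NormedAddCommGroup E]
    (P : TaggedDivision a b) (U : ℝ → ℝ → E) : E :=
  ∑ j ∈ Finset.range P.size, (U (P.tag j) (P.pt (j + 1)) - U (P.tag j) (P.pt j))

/-- `∫_a^b DU(τ, t)` exists and equals `I`, for `a ≤ b` (for `a = b` this means `I = 0`). -/
def HasKurzweilIntegral {E : Type*} [NormedAddCommGroup E] (U : ℝ → ℝ → E) (a b : ℝ) (I : E) :
    Prop :=
  a ≤ b ∧ ∀ ε > 0, ∃ δ : ℝ → ℝ, (∀ τ ∈ Icc a b, 0 < δ τ) ∧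
    ∀ P : TaggedDivision a b, P.IsFine δ → ‖P.kurzweilSum U - I‖ < ε

/-- The Kurzweil–Stieltjes integral `∫_a^b g dh` exists and equals `I`. -/
def HasKSIntegral {E : Type*} [NormedAddCommGroup E] [NormedSpace ℝ E] (g : ℝ → E) (h : ℝ → ℝ)
    (a b : ℝ) (I : E) : Prop :=
  HasKurzweilIntegral (fun τ t => h t • g τ) a b I

/-- The Kurzweil–Stieltjes integral `∫_a^b g dh` exists. -/
def KSIntegrable {E : Type*} [NormedAddCommGroup E] [NormedSpace ℝ E] (g : ℝ → E) (h : ℝ → ℝ)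
    (a b : ℝ) : Prop :=
  ∃ I : E, HasKSIntegral g h a b I

open Classical in
/-- The value of `∫_a^b g dh` (and `0` if the integral does not exist). -/
noncomputable def ksIntegral {E : Type*} [NormedAddCommGroup E] [NormedSpace ℝ E] (g : ℝ → E)
    (h : ℝ → ℝ) (a b : ℝ) : E :=
  if H : KSIntegrable g h a b then H.choose else 0

/-- `var_a^t h`. -/
noncomputable def varFrom (h : ℝ → ℝ) (a t : ℝ) : ℝ := (eVariationOn h (Icc a t)).toReal

/-! ### Test functions and vector distributions on `[0, T]` -/

/-- The space `𝒟` of smooth functions all of whose derivatives vanish outside `(0, T)`. -/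
def testSpace (T : ℝ) : Submodule ℝ (ℝ → ℝ) where
  carrier := {φ | ContDiff ℝ ∞ φ ∧ ∀ (j : ℕ) (t : ℝ), t ∉ Ioo 0 T → iteratedDeriv j φ t = 0}
  zero_mem' := by
    refine ⟨contDiff_const, fun j t _ => ?_⟩
    have h0 : (0 : ℝ → ℝ) = fun _ => 0 := rfl
    rw [h0, iteratedDeriv_const]
    simp
  add_mem' := by
    rintro φ ψ ⟨hφ, hφ'⟩ ⟨hψ, hψ'⟩
    refine ⟨hφ.add hψ, fun j t ht => ?_⟩
    rw [iteratedDeriv_add ((hφ.of_le (by exact_mod_cast le_top)).contDiffAt)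
      ((hψ.of_le (by exact_mod_cast le_top)).contDiffAt), hφ' j t ht, hψ' j t ht, add_zero]
  smul_mem' := by
    rintro c φ ⟨hφ, hφ'⟩
    refine ⟨contDiff_const.smul hφ, fun j t ht => ?_⟩
    rw [iteratedDeriv_const_smul ((hφ.of_le (by exact_mod_cast le_top)).contDiffAt), hφ' j t ht,
      smul_zero]

/-- The Cartesian power `𝒟ⁿ`. -/
abbrev VecTest (n : ℕ) (T : ℝ) : Type := Fin n → testSpace T

/-- `φ_k → φ` in `𝒟ⁿ`: for every order `j`, the `j`-th derivatives of all components converge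
uniformly on `ℝ`. -/
def TestTendsto {n : ℕ} {T : ℝ} (Φ : ℕ → VecTest n T) (φ : VecTest n T) : Prop :=
  ∀ (i : Fin n) (j : ℕ), TendstoUniformly (fun k => iteratedDeriv j (Φ k i : ℝ → ℝ))
    (iteratedDeriv j (φ i : ℝ → ℝ)) atTop

/-- The `n`-vector distributions on `[0, T]`: the linear functionals on `𝒟ⁿ` which are continuous
for the convergence of `𝒟ⁿ`. -/
def vecDistribution (n : ℕ) (T : ℝ) : Submodule ℝ (VecTest n T →ₗ[ℝ] ℝ) where
  carrier := {L | ∀ (Φ : ℕ → VecTest n T) (φ : VecTest n T), TestTendsto Φ φ →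
    Tendsto (fun k => L (Φ k)) atTop (𝓝 (L φ))}
  zero_mem' := fun _ _ _ => tendsto_const_nhds
  add_mem' := fun hK hL Φ φ hΦ => (hK Φ φ hΦ).add (hL Φ φ hΦ)
  smul_mem' := fun c _ hL Φ φ hΦ => (hL Φ φ hΦ).const_mul c

/-- The derivative `φ'` of a test function, as a linear map on `𝒟`. -/
noncomputable def testDeriv (T : ℝ) : testSpace T →ₗ[ℝ] testSpace T where
  toFun φ := ⟨deriv (φ : ℝ → ℝ), by
    refine ⟨(contDiff_infty_iff_deriv.1 φ.2.1).2, fun j t ht => ?_⟩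
    rw [← iteratedDeriv_succ']
    exact φ.2.2 (j + 1) t ht⟩
  map_add' φ ψ := by
    ext t
    exact deriv_add ((contDiff_infty_iff_deriv.1 φ.2.1).1 t) ((contDiff_infty_iff_deriv.1 ψ.2.1).1 t)
  map_smul' c φ := by
    ext t
    exact deriv_const_smul c ((contDiff_infty_iff_deriv.1 φ.2.1).1 t)

/-- The value `⟨d, φ⟩` of a distribution on a test function. -/
def pairing {n : ℕ} {T : ℝ} (d : vecDistribution n T) (φ : VecTest n T) : ℝ := d.1 φ

/-- The componentwise derivative `φ'` of `φ ∈ 𝒟ⁿ`. -/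
noncomputable def vecTestDeriv (n : ℕ) (T : ℝ) : VecTest n T →ₗ[ℝ] VecTest n T :=
  LinearMap.pi fun i => testDeriv T ∘ₗ LinearMap.proj i

/-- The distributional derivative, `⟨Dd, φ⟩ = -⟨d, φ'⟩`. -/
noncomputable def distDeriv {n : ℕ} {T : ℝ} (d : vecDistribution n T) : vecDistribution n T :=
  ⟨-((d : VecTest n T →ₗ[ℝ] ℝ) ∘ₗ vecTestDeriv n T), by
    intro Φ φ hΦ
    refine (d.2 (fun k => vecTestDeriv n T (Φ k)) (vecTestDeriv n T φ) fun i j => ?_).neg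
    have key : ∀ ψ : VecTest n T, iteratedDeriv j (vecTestDeriv n T ψ i : ℝ → ℝ)
        = iteratedDeriv (j + 1) (ψ i : ℝ → ℝ) := fun ψ => by
      rw [iteratedDeriv_succ']; rfl
    simp only [key]
    exact hΦ i (j + 1)⟩

/-- `u ∈ L¹[0, T]`. -/
def IsL1 {n : ℕ} (T : ℝ) (u : ℝ → Vec n) : Prop := IntegrableOn u (Icc 0 T)

lemma integrableOn_coord_mul {n : ℕ} {T : ℝ} {u : ℝ → Vec n} (hu : IsL1 T u)
    (i : Fin n) {ψ : ℝ → ℝ} (hψ : Continuous ψ) :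
    IntegrableOn (fun t => u t i * ψ t) (Icc 0 T) := by
  have h1 : IntegrableOn (fun t => u t i) (Icc 0 T) := Integrable.eval hu i
  exact h1.mul_continuousOn hψ.continuousOn isCompact_Icc

/-- The distribution `⟨u, φ⟩ = ∫_0^T u(t) φ(t) dt` (scalar product of vectors under the integral)
of a function `u` which is Lebesgue integrable on `[0, T]`. -/
noncomputable def distOfFun {n : ℕ} {T : ℝ} (u : ℝ → Vec n) (hu : IsL1 T u) :
    vecDistribution n T :=
  ⟨{  toFun := fun φ => ∫ t in Icc 0 T, ∑ i, u t i * (φ i : ℝ → ℝ) t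
      map_add' := fun φ ψ => by
        rw [← integral_add
          (integrable_finsetSum _ fun i _ => integrableOn_coord_mul hu i (φ i).2.1.continuous)
          (integrable_finsetSum _ fun i _ => integrableOn_coord_mul hu i (ψ i).2.1.continuous)]
        simp [mul_add, Finset.sum_add_distrib]
      map_smul' := fun c φ => by
        simp only [RingHom.id_apply, smul_eq_mul, ← integral_const_mul]
        congr 1
        ext t
        simp only [Pi.smul_apply, SetLike.val_smul, smul_eq_mul, Finset.mul_sum]
        exact Finset.sum_congr rfl fun i _ => by ring }, by
    intro Φ φ hΦ
    have hunif : ∀ i, TendstoUniformly (fun k => (Φ k i : ℝ → ℝ)) (φ i : ℝ → ℝ) atTop := fun i => by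
      simpa using hΦ i 0
    refine tendsto_integral_filter_of_dominated_convergence
      (fun t => ∑ i, ‖u t i * (|(φ i : ℝ → ℝ) t| + 1)‖) (.of_forall fun k => ?_) ?_ ?_ ?_
    · exact (integrable_finsetSum _ fun i _ =>
        integrableOn_coord_mul hu i (Φ k i).2.1.continuous).aestronglyMeasurable
    · have hev : ∀ᶠ k in atTop, ∀ i t, dist ((φ i : ℝ → ℝ) t) ((Φ k i : ℝ → ℝ) t) < 1 :=
        eventually_all.2 fun i => Metric.tendstoUniformly_iff.1 (hunif i) 1 one_pos
      filter_upwards [hev] with k hk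
      refine .of_forall fun t => (norm_sum_le _ _).trans (Finset.sum_le_sum fun i _ => ?_)
      rw [norm_mul, norm_mul]
      refine mul_le_mul_of_nonneg_left ?_ (norm_nonneg _)
      have h1 := hk i t
      rw [Real.dist_eq, abs_sub_comm] at h1
      have h2 := abs_sub_abs_le_abs_sub ((Φ k i : ℝ → ℝ) t) ((φ i : ℝ → ℝ) t)
      rw [Real.norm_eq_abs, Real.norm_eq_abs, abs_of_nonneg (a := |_| + 1) (by positivity)]
      linarith
    · exact integrable_finsetSum _ fun i _ =>
        (integrableOn_coord_mul hu i ((φ i).2.1.continuous.abs.add continuous_const)).norm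
    · refine .of_forall fun t => tendsto_finsetSum _ fun i _ => ?_
      exact ((hunif i).tendsto_at t).const_mul _⟩

/-! ### The measure differential equation and the Stieltjes integral equation -/

/-- The product `g . Dh` has a sense and equals `P`: the integral `∫_0^T g dh` exists, and `P` is
the distributional derivative of the indefinite integral `t ↦ ∫_0^t g dh`. -/
def IsKSProduct {n : ℕ} {T : ℝ} (g : ℝ → Vec n) (h : ℝ → ℝ) (P : vecDistribution n T) : Prop :=
  KSIntegrable g h 0 T ∧
    ∃ hH : IsL1 T (fun t => ksIntegral g h 0 t),
      P = distDeriv (distOfFun (fun t => ksIntegral g h 0 t) hH)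

/-- `(x, lam)` solves `Dx = f(lam, x, t) + g(x, t) . Dh` on `[0, T]`: `x` has bounded variation on
`[0, T]`, is left-continuous on `(0, T]`, has values in `Ω`, the product `g(x(t), t) . Dh` has a
sense and `⟨Dx, φ⟩ = ⟨f(lam, x(·), ·), φ⟩ + ⟨g(x(·), ·) . Dh, φ⟩` for all `φ ∈ 𝒟ⁿ`. -/
def IsMDESolution {n : ℕ} (T : ℝ) (Ω : Set (Vec n)) (f : ℝ → Vec n → ℝ → Vec n)
    (g : Vec n → ℝ → Vec n) (h : ℝ → ℝ) (lam : ℝ) (x : ℝ → Vec n) : Prop :=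
  BoundedVariationOn x (Icc 0 T) ∧ IsLeftContinuousOn x (Ioc 0 T) ∧ (∀ t ∈ Icc 0 T, x t ∈ Ω) ∧
    ∃ (P : vecDistribution n T) (hx : IsL1 T x) (hf : IsL1 T (fun t => f lam (x t) t)),
      IsKSProduct (fun t => g (x t) t) h P ∧
        ∀ φ : VecTest n T, pairing (distDeriv (distOfFun x hx)) φ
          = pairing (distOfFun (fun t => f lam (x t) t) hf) φ + pairing P φ

/-- `x` satisfies
`x(t) = x(s) + ∫_s^t f(lam, x(r), r) dr + ∫_s^t g(x(r), r) dh(r)`,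
both integrals existing as Kurzweil–Stieltjes integrals. -/
def StieltjesEquationAt {n : ℕ} (f : ℝ → Vec n → ℝ → Vec n)
    (g : Vec n → ℝ → Vec n) (h : ℝ → ℝ) (lam : ℝ) (x : ℝ → Vec n) (s t : ℝ) : Prop :=
  KSIntegrable (fun r => f lam (x r) r) (fun r => r) s t ∧
    KSIntegrable (fun r => g (x r) r) h s t ∧
      x t = x s + ksIntegral (fun r => f lam (x r) r) (fun r => r) s t
        + ksIntegral (fun r => g (x r) r) h s t

/-- `x` solves the Stieltjes integral equation
`x(t) = x(0) + ∫_0^t f(lam, x(s), s) ds + ∫_0^t g(x(s), s) dh(s)`, `t ∈ [0, T]`. -/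
def IsSIESolution {n : ℕ} (T : ℝ) (Ω : Set (Vec n)) (f : ℝ → Vec n → ℝ → Vec n)
    (g : Vec n → ℝ → Vec n) (h : ℝ → ℝ) (lam : ℝ) (x : ℝ → Vec n) : Prop :=
  (∀ t ∈ Icc 0 T, x t ∈ Ω) ∧ ∀ t ∈ Icc 0 T, StieltjesEquationAt f g h lam x 0 t

/-! ### Tagged divisions -/

namespace TaggedDivision

variable {a b c : ℝ}

/-! Put `w(t) = x(t) - ∫_0^t f(λ,x(s),s) ds - ∫_0^t g(x(s),s) dh(s)`. The integral equation says
that `w` is constant on `[0,T]`, the measure differential equation that the distributional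
derivative of `w` is zero (`distDeriv_eq_add_iff`). A vanishing derivative makes `w` almost
everywhere constant, by the lemma of du Bois-Reymond, and left-continuity of `x` and `h` turns this
into constancy on `(0,T]` (`IsMDESolution.exists_sub_eq`). Additivity of the integrals then gives
(b).

The value `w(0)` is invisible to distributions, and this is all that the initial condition repairs.
A Kurzweil–Stieltjes integral inherits the jumps of its integrator: `∫_0^s g dh` tends to
`g(x(0),0)(h(0+) - h(0))` as `s` decreases to `0`, while `∫_0^s f ds` tends to `0`
(`KSIntegrable.tendsto_right`). Hence the jump condition says exactly that `w(0+) = w(0)`.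

In the direction from the integral equation, the regularity in the definition of a solution has to
be recovered. The increments of the two indefinite integrals are dominated by those of `∫ m ds` and
`∫ m_h d[var h]` (`HasKSIntegral.norm_le`), so `x` has bounded variation. Then `x` is measurable,
Carathéodory superposition makes `f(λ,x(·),·)` Lebesgue integrable, and its Kurzweil and Lebesgue
integrals agree (`hasKSIntegral_id`). -/

lemma pt_le_succ (P : TaggedDivision a b) {j : ℕ} (hj : j < P.size) : P.pt j ≤ P.pt (j + 1) :=
  (P.tag_mem j hj).1.trans (P.tag_mem j hj).2

lemma left_le_pt (P : TaggedDivision a b) {j : ℕ} (hj : j ≤ P.size) : a ≤ P.pt j := by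
  induction j with
  | zero => exact P.pt_zero.ge
  | succ j ih => exact (ih (by omega)).trans (P.pt_le_succ (by omega))

lemma pt_le_right (P : TaggedDivision a b) {j : ℕ} (hj : j ≤ P.size) : P.pt j ≤ b := by
  induction hj using Nat.decreasingInduction with
  | self => exact P.pt_size.le
  | of_succ k hk ih => exact (P.pt_le_succ hk).trans ih

lemma pt_mem (P : TaggedDivision a b) {j : ℕ} (hj : j ≤ P.size) : P.pt j ∈ Icc a b :=
  ⟨P.left_le_pt hj, P.pt_le_right hj⟩

lemma tag_mem_Icc (P : TaggedDivision a b) {j : ℕ} (hj : j < P.size) : P.tag j ∈ Icc a b :=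
  ⟨(P.left_le_pt hj.le).trans (P.tag_mem j hj).1, (P.tag_mem j hj).2.trans (P.pt_le_right hj)⟩

lemma IsFine.mono {P : TaggedDivision a b} {δ δ' : ℝ → ℝ} (hP : P.IsFine δ)
    (h : ∀ t ∈ Icc a b, δ t ≤ δ' t) : P.IsFine δ' := fun j hj => by
  have := h _ (P.tag_mem_Icc hj)
  exact (hP j hj).trans (Ioo_subset_Ioo (by linarith) (by linarith))

/-- The division of `[a, b]` with the single tag `τ`. -/
def single {τ : ℝ} (hτ : τ ∈ Icc a b) : TaggedDivision a b where
  size := 1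
  pt j := if j = 0 then a else b
  tag _ := τ
  pt_zero := rfl
  pt_size := rfl
  tag_mem j hj := by
    obtain rfl : j = 0 := by omega
    exact hτ

lemma single_isFine {τ : ℝ} (hτ : τ ∈ Icc a b) {δ : ℝ → ℝ} (ha : τ - δ τ < a)
    (hb : b < τ + δ τ) : (single hτ).IsFine δ := by
  intro j hj
  obtain rfl : j = 0 := Nat.lt_one_iff.1 hj
  exact fun t ht => ⟨ha.trans_le ht.1, ht.2.trans_lt hb⟩

lemma kurzweilSum_single {E : Type*} [NormedAddCommGroup E] {τ : ℝ} (hτ : τ ∈ Icc a b)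
    (U : ℝ → ℝ → E) : (single hτ).kurzweilSum U = U τ b - U τ a := by
  simp [single, kurzweilSum]

/-- The concatenation of divisions of `[a, b]` and `[b, c]`. -/
def concat (P : TaggedDivision a b) (Q : TaggedDivision b c) : TaggedDivision a c where
  size := P.size + Q.size
  pt j := if j < P.size then P.pt j else Q.pt (j - P.size)
  tag j := if j < P.size then P.tag j else Q.tag (j - P.size)
  pt_zero := by
    split_ifs with h
    · exact P.pt_zero
    · have h0 : P.size = 0 := by omega
      rw [Nat.zero_sub, Q.pt_zero, ← P.pt_size, h0, P.pt_zero]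
  pt_size := by simp [Q.pt_size]
  tag_mem j hj := by
    rcases lt_trichotomy (j + 1) P.size with h | h | h
    · have h' : j < P.size := by omega
      rw [if_pos h', if_pos h', if_pos h]
      exact P.tag_mem j (by omega)
    -- The last cell of `P`: its right end is read off as `Q.pt 0`, which is `b` just as `P.pt
    -- P.size` is.
    · have h' : j < P.size := by omega
      have h1 : P.pt (j + 1) = b := by rw [h, P.pt_size]
      rw [if_pos h', if_pos h', if_neg h.ge.not_gt, h, Nat.sub_self, Q.pt_zero]
      simpa only [h1] using P.tag_mem j h'
    · have h' : ¬ j < P.size := by omega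
      rw [if_neg h', if_neg h', if_neg h.not_gt, Nat.sub_add_comm (by omega)]
      exact Q.tag_mem _ (by omega)

lemma concat_pt_of_le (P : TaggedDivision a b) (Q : TaggedDivision b c) {j : ℕ}
    (hj : j ≤ P.size) : (P.concat Q).pt j = P.pt j := by
  rcases hj.lt_or_eq with h | rfl
  · exact if_pos h
  · simp [concat, P.pt_size, Q.pt_zero]

lemma concat_pt_add (P : TaggedDivision a b) (Q : TaggedDivision b c) (j : ℕ) :
    (P.concat Q).pt (P.size + j) = Q.pt j := by
  simp [concat]

lemma concat_tag_of_lt (P : TaggedDivision a b) (Q : TaggedDivision b c) {j : ℕ}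
    (hj : j < P.size) : (P.concat Q).tag j = P.tag j := if_pos hj

lemma concat_tag_add (P : TaggedDivision a b) (Q : TaggedDivision b c) (j : ℕ) :
    (P.concat Q).tag (P.size + j) = Q.tag j := by
  simp [concat]

lemma IsFine.concat {P : TaggedDivision a b} {Q : TaggedDivision b c} {δ : ℝ → ℝ}
    (hP : P.IsFine δ) (hQ : Q.IsFine δ) : (P.concat Q).IsFine δ := by
  intro j hj
  rcases lt_or_ge j P.size with h | h
  · rw [concat_pt_of_le _ _ h.le, concat_pt_of_le _ _ h, concat_tag_of_lt _ _ h]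
    exact hP j h
  · obtain ⟨k, rfl⟩ := Nat.exists_eq_add_of_le h
    rw [add_assoc, concat_pt_add, concat_pt_add, concat_tag_add]
    exact hQ k (Nat.add_lt_add_iff_left.1 hj)

lemma kurzweilSum_concat {E : Type*} [NormedAddCommGroup E] (P : TaggedDivision a b)
    (Q : TaggedDivision b c) (U : ℝ → ℝ → E) :
    (P.concat Q).kurzweilSum U = P.kurzweilSum U + Q.kurzweilSum U := by
  have hs : (P.concat Q).size = P.size + Q.size := rfl
  rw [kurzweilSum, hs, Finset.sum_range_add]
  congr 1
  · refine Finset.sum_congr rfl fun j hj => ?_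
    have h := Finset.mem_range.1 hj
    rw [concat_pt_of_le _ _ h.le, concat_pt_of_le _ _ h, concat_tag_of_lt _ _ h]
  · refine Finset.sum_congr rfl fun j _ => ?_
    rw [add_assoc, concat_pt_add, concat_pt_add, concat_tag_add]

/-- Cousin's lemma. -/
theorem exists_isFine (hab : a ≤ b) {δ : ℝ → ℝ} (hδ : ∀ t ∈ Icc a b, 0 < δ t) :
    ∃ P : TaggedDivision a b, P.IsFine δ := by
  set S : Set ℝ := {t | t ∈ Icc a b ∧ ∃ P : TaggedDivision a t, P.IsFine δ} with hS
  have haS : a ∈ S := by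
    have ha := left_mem_Icc.2 hab
    have := hδ a ha
    exact ⟨ha, single (left_mem_Icc.2 le_rfl), single_isFine _ (by linarith) (by linarith)⟩
  have hbdd : BddAbove S := ⟨b, fun t ht => ht.1.2⟩
  set c := sSup S with hc
  have hac : a ≤ c := le_csSup hbdd haS
  have hcb : c ≤ b := csSup_le ⟨a, haS⟩ fun t ht => ht.1.2
  have hδc := hδ c ⟨hac, hcb⟩
  -- A division reaching some `s` within `δ c` of the supremum `c` can be prolonged by one cell
  -- tagged at `c`. This cell passes beyond `c` unless `c = b`.
  obtain ⟨s, hsS, hs⟩ := exists_lt_of_lt_csSup ⟨a, haS⟩ (show c - δ c < sSup S by linarith)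
  have hsc : s ≤ c := le_csSup hbdd hsS
  have key : ∀ u ∈ Icc c b, u < c + δ c → u ∈ S := fun u hu hu' => by
    obtain ⟨P, hP⟩ := hsS.2
    exact ⟨⟨hac.trans hu.1, hu.2⟩, P.concat (single ⟨hsc, hu.1⟩),
      hP.concat (single_isFine _ hs hu')⟩
  rcases hcb.lt_or_eq with h | h
  · have hm : min b (c + δ c / 2) ∈ S :=
      key _ ⟨le_min hcb (by linarith), min_le_left _ _⟩ ((min_le_right _ _).trans_lt (by linarith))
    have h1 : c < min b (c + δ c / 2) := lt_min h (by linarith)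
    exact absurd (le_csSup hbdd hm) (not_le.2 h1)
  · exact (key b ⟨hcb, le_rfl⟩ (by linarith)).2

/-- The filter of tagged divisions generated by the sets of `δ`-fine ones. -/
def fineFilter (a b : ℝ) : Filter (TaggedDivision a b) :=
  ⨅ (δ : ℝ → ℝ) (_ : ∀ t ∈ Icc a b, 0 < δ t), 𝓟 {P | P.IsFine δ}

lemma hasBasis_fineFilter (a b : ℝ) :
    (fineFilter a b).HasBasis (fun δ : ℝ → ℝ => ∀ t ∈ Icc a b, 0 < δ t) fun δ => {P | P.IsFine δ} :=
  hasBasis_biInf_principal' (fun δ hδ δ' hδ' =>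
    ⟨fun t => min (δ t) (δ' t), fun t ht => lt_min (hδ t ht) (hδ' t ht),
      fun _ hP => IsFine.mono (mem_ofPred_eq ▸ hP) fun _ _ => min_le_left _ _,
      fun _ hP => IsFine.mono (mem_ofPred_eq ▸ hP) fun _ _ => min_le_right _ _⟩) ⟨fun _ => 1, fun _ _ => one_pos⟩

/-- This is Cousin's lemma in filter form; it is what makes limits along fine divisions unique. -/
lemma fineFilter_neBot (hab : a ≤ b) : (fineFilter a b).NeBot :=
  (hasBasis_fineFilter a b).neBot_iff.2 fun hδ => exists_isFine hab hδ

/-- A gauge on `[a, c]` restricts to both halves, so a limit over `[a, c]` may be computed along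
concatenations only. Additivity of the integral follows. -/
lemma tendsto_concat (hab : a ≤ b) (hbc : b ≤ c) :
    Tendsto (fun p : TaggedDivision a b × TaggedDivision b c => p.1.concat p.2)
      (fineFilter a b ×ˢ fineFilter b c) (fineFilter a c) := by
  refine (hasBasis_fineFilter a c).tendsto_right_iff.2 fun δ hδ => ?_
  have h1 : ∀ᶠ P in fineFilter a b, P.IsFine δ :=
    (hasBasis_fineFilter a b).mem_of_mem fun t ht => hδ t ⟨ht.1, ht.2.trans hbc⟩
  have h2 : ∀ᶠ Q in fineFilter b c, Q.IsFine δ :=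
    (hasBasis_fineFilter b c).mem_of_mem fun t ht => hδ t ⟨hab.trans ht.1, ht.2⟩
  exact (h1.prod_mk h2).mono fun p hp => hp.1.concat hp.2

end TaggedDivision

/-! ### The Kurzweil integral -/

section Kurzweil

open TaggedDivision

variable {E : Type*} [NormedAddCommGroup E] {U : ℝ → ℝ → E} {a b c d : ℝ} {I J K : E}

/-- With the integral written as a limit along a filter, uniqueness, sums and comparison come from
the general theory of limits. -/
lemma hasKurzweilIntegral_iff :
    HasKurzweilIntegral U a b I ↔
      a ≤ b ∧ Tendsto (fun P => kurzweilSum P U) (fineFilter a b) (𝓝 I) := by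
  refine and_congr_right fun _ => ?_
  rw [(hasBasis_fineFilter a b).tendsto_iff Metric.nhds_basis_ball]
  simp [dist_eq_norm]

lemma HasKurzweilIntegral.tendsto (h : HasKurzweilIntegral U a b I) :
    Tendsto (fun P => kurzweilSum P U) (fineFilter a b) (𝓝 I) :=
  (hasKurzweilIntegral_iff.1 h).2

lemma HasKurzweilIntegral.unique (hI : HasKurzweilIntegral U a b I)
    (hJ : HasKurzweilIntegral U a b J) : I = J :=
  have := fineFilter_neBot hI.1
  tendsto_nhds_unique hI.tendsto hJ.tendsto

lemma HasKurzweilIntegral.eq_add (h : HasKurzweilIntegral U a c I)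
    (h₁ : HasKurzweilIntegral U a b J) (h₂ : HasKurzweilIntegral U b c K) : I = J + K := by
  have := fineFilter_neBot h₁.1
  have := fineFilter_neBot h₂.1
  refine tendsto_nhds_unique (h.tendsto.comp (tendsto_concat h₁.1 h₂.1)) ?_
  simpa only [Function.comp_def, kurzweilSum_concat] using
    (h₁.tendsto.comp tendsto_fst).add (h₂.tendsto.comp tendsto_snd)

lemma exists_hasKurzweilIntegral_iff [CompleteSpace E] (hab : a ≤ b) :
    (∃ I, HasKurzweilIntegral U a b I) ↔ ∀ ε > 0, ∃ δ : ℝ → ℝ, (∀ t ∈ Icc a b, 0 < δ t) ∧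
      ∀ P Q : TaggedDivision a b, P.IsFine δ → Q.IsFine δ →
        dist (P.kurzweilSum U) (Q.kurzweilSum U) < ε := by
  have := fineFilter_neBot hab
  simp only [hasKurzweilIntegral_iff, hab, true_and]
  rw [← cauchy_map_iff_exists_tendsto, cauchy_map_iff',
    ((hasBasis_fineFilter a b).prod_self).tendsto_iff Metric.uniformity_basis_dist]
  simp only [mem_prod, mem_ofPred_eq, Prod.forall, and_imp]

/-- By the Cauchy criterion: two fine divisions of `[a, b]` are completed by the same fine division
`R` of `[b, c]`, whose contribution cancels in the distance. -/
lemma HasKurzweilIntegral.exists_left [CompleteSpace E] (h : HasKurzweilIntegral U a c I)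
    (hab : a ≤ b) (hbc : b ≤ c) : ∃ J, HasKurzweilIntegral U a b J := by
  rw [exists_hasKurzweilIntegral_iff hab]
  intro ε hε
  obtain ⟨δ, hδ, H⟩ := (exists_hasKurzweilIntegral_iff h.1).1 ⟨I, h⟩ ε hε
  obtain ⟨R, hR⟩ := exists_isFine hbc fun t ht => hδ t ⟨hab.trans ht.1, ht.2⟩
  refine ⟨δ, fun t ht => hδ t ⟨ht.1, ht.2.trans hbc⟩, fun P Q hP hQ => ?_⟩
  have := H _ _ (hP.concat hR) (hQ.concat hR)
  rwa [kurzweilSum_concat, kurzweilSum_concat, dist_add_right] at this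

lemma HasKurzweilIntegral.exists_right [CompleteSpace E] (h : HasKurzweilIntegral U a c I)
    (hab : a ≤ b) (hbc : b ≤ c) : ∃ J, HasKurzweilIntegral U b c J := by
  rw [exists_hasKurzweilIntegral_iff hbc]
  intro ε hε
  obtain ⟨δ, hδ, H⟩ := (exists_hasKurzweilIntegral_iff h.1).1 ⟨I, h⟩ ε hε
  obtain ⟨R, hR⟩ := exists_isFine hab fun t ht => hδ t ⟨ht.1, ht.2.trans hbc⟩
  refine ⟨δ, fun t ht => hδ t ⟨hab.trans ht.1, ht.2⟩, fun P Q hP hQ => ?_⟩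
  have := H _ _ (hR.concat hP) (hR.concat hQ)
  rwa [kurzweilSum_concat, kurzweilSum_concat, dist_add_left] at this

/-- The behaviour of the indefinite integral to the left of the upper end point. -/
lemma HasKurzweilIntegral.tendsto_left {G : ℝ → E} (hab : a < b)
    (hG : ∀ t ∈ Icc a b, HasKurzweilIntegral U a t (G t)) :
    Tendsto (fun s => G s + (U b b - U b s)) (𝓝[<] b) (𝓝 (G b)) := by
  refine Metric.tendsto_nhds.2 fun ε hε => ?_
  obtain ⟨-, h⟩ := hG b (right_mem_Icc.2 hab.le)
  obtain ⟨δ, hδ, H⟩ := h (ε / 2) (half_pos hε)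
  have hδb := hδ b (right_mem_Icc.2 hab.le)
  filter_upwards [Ioo_mem_nhdsLT (max_lt hab (sub_lt_self b hδb))] with s hs
  have has : a < s := (le_max_left _ _).trans_lt hs.1
  have := fineFilter_neBot has.le
  have hlim := ((hG s ⟨has.le, hs.2.le⟩).tendsto.add_const (U b b - U b s)).dist
    (tendsto_const_nhds (x := G b))
  -- The gauge `δ` stays fixed while the divisions of `[a, s]` are refined and a single cell `[s,
  -- b]` tagged at `b` is appended. Only a weak inequality survives the limit, hence `ε / 2`.
  refine (le_of_tendsto hlim ?_).trans_lt (half_lt_self hε)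
  filter_upwards [(hasBasis_fineFilter a s).mem_of_mem
    fun t ht => hδ t ⟨ht.1, ht.2.trans hs.2.le⟩] with P hP
  have hb : b ∈ Icc s b := right_mem_Icc.2 hs.2.le
  have hfine := single_isFine hb (δ := δ)
    ((le_max_right _ _).trans_lt hs.1) (by linarith)
  have := H _ (IsFine.concat hP hfine)
  rw [kurzweilSum_concat, kurzweilSum_single] at this
  rw [dist_eq_norm]
  exact this.le

/-- The behaviour of the indefinite integral to the right of the lower end point. -/
lemma HasKurzweilIntegral.tendsto_right [CompleteSpace E] {G : ℝ → E} (hab : a < b)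
    (hG : ∀ t ∈ Icc a b, HasKurzweilIntegral U a t (G t)) :
    Tendsto (fun s => G s - (U a s - U a a)) (𝓝[>] a) (𝓝 0) := by
  refine Metric.tendsto_nhds.2 fun ε hε => ?_
  have hGb := hG b (right_mem_Icc.2 hab.le)
  obtain ⟨δ, hδ, H⟩ := hGb.2 (ε / 2) (half_pos hε)
  have hδa := hδ a (left_mem_Icc.2 hab.le)
  filter_upwards [Ioo_mem_nhdsGT (lt_min hab (lt_add_of_pos_right a hδa))] with s hs
  have hsb : s < b := hs.2.trans_le (min_le_left _ _)
  have := fineFilter_neBot hsb.le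
  obtain ⟨J, hJ⟩ := hGb.exists_right hs.1.le hsb.le
  have hlim := (hJ.tendsto.const_add (U a s - U a a)).dist (tendsto_const_nhds (x := G b))
  have hle : dist (U a s - U a a + J) (G b) ≤ ε / 2 := by
    refine le_of_tendsto hlim ?_
    filter_upwards [(hasBasis_fineFilter s b).mem_of_mem
      fun t ht => hδ t ⟨hs.1.le.trans ht.1, ht.2⟩] with P hP
    have ha : a ∈ Icc a s := left_mem_Icc.2 hs.1.le
    have hfine := single_isFine ha (δ := δ)
      (by linarith) (hs.2.trans_le (min_le_right _ _))
    have := H _ (IsFine.concat hfine hP)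
    rw [kurzweilSum_concat, kurzweilSum_single] at this
    rw [dist_eq_norm]
    exact this.le
  -- Additivity splits `G b` as `G s + J`, and the common `J` drops out.
  rw [hGb.eq_add (hG s ⟨hs.1.le, hsb.le⟩) hJ, dist_add_right, dist_comm, dist_eq_norm] at hle
  rw [dist_zero_right]
  exact hle.trans_lt (half_lt_self hε)

end Kurzweil

/-! ### The Kurzweil–Stieltjes integral -/

section KurzweilStieltjes

open TaggedDivision

variable {E : Type*} [NormedAddCommGroup E] [NormedSpace ℝ E] {g : ℝ → E} {h : ℝ → ℝ}
  {a b c d : ℝ} {I : E}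

lemma KSIntegrable.hasKSIntegral (H : KSIntegrable g h a b) :
    HasKSIntegral g h a b (ksIntegral g h a b) := by
  rw [ksIntegral, dif_pos H]
  exact H.choose_spec

lemma HasKSIntegral.ksIntegral_eq (H : HasKSIntegral g h a b I) : ksIntegral g h a b = I :=
  (KSIntegrable.hasKSIntegral ⟨I, H⟩).unique H

lemma KSIntegrable.mono [CompleteSpace E] (H : KSIntegrable g h a d) (hab : a ≤ b) (hbc : b ≤ c)
    (hcd : c ≤ d) : KSIntegrable g h b c := by
  obtain ⟨I, hI⟩ := H
  obtain ⟨J, hJ⟩ := HasKurzweilIntegral.exists_left hI (hab.trans hbc) hcd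
  exact hJ.exists_right hab hbc

lemma ksIntegral_add [CompleteSpace E] (H : KSIntegrable g h a c) (hab : a ≤ b) (hbc : b ≤ c) :
    ksIntegral g h a c = ksIntegral g h a b + ksIntegral g h b c :=
  HasKurzweilIntegral.eq_add H.hasKSIntegral (H.mono le_rfl hab hbc).hasKSIntegral
    (H.mono hab hbc le_rfl).hasKSIntegral

lemma ksIntegral_self (g : ℝ → E) (h : ℝ → ℝ) (a : ℝ) : ksIntegral g h a a = 0 := by
  refine HasKSIntegral.ksIntegral_eq ⟨le_rfl, fun ε hε => ⟨fun _ => 1, fun _ _ => one_pos,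
    fun P _ => ?_⟩⟩
  have hpt : ∀ j ≤ P.size, P.pt j = a := fun j hj =>
    le_antisymm (P.pt_le_right hj) (P.left_le_pt hj)
  rw [sub_zero, kurzweilSum, Finset.sum_eq_zero fun j hj => ?_, norm_zero]
  · exact hε
  · have := Finset.mem_range.1 hj
    rw [hpt _ this.le, hpt _ this, sub_self]

lemma hasKSIntegral_pi {n : ℕ} {g : ℝ → Vec n} {I : Vec n} (hab : a ≤ b)
    (H : ∀ i, HasKSIntegral (fun t => g t i) h a b (I i)) : HasKSIntegral g h a b I := by
  refine hasKurzweilIntegral_iff.2 ⟨hab, tendsto_pi_nhds.2 fun i => ?_⟩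
  refine (HasKurzweilIntegral.tendsto (H i)).congr fun P => ?_
  simp [kurzweilSum, Finset.sum_apply]

/-- Comparison of Kurzweil–Stieltjes integrals. -/
lemma HasKSIntegral.norm_le {m V : ℝ → ℝ} {M : ℝ} (hI : HasKSIntegral g h a b I)
    (hM : HasKSIntegral m V a b M) (hg : ∀ t ∈ Icc a b, ‖g t‖ ≤ m t)
    (hV : ∀ s ∈ Icc a b, ∀ t ∈ Icc a b, s ≤ t → |h t - h s| ≤ V t - V s) : ‖I‖ ≤ M := by
  have := fineFilter_neBot hI.1
  -- Both integrals are limits along the same filter, so the sums can be compared term by term on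
  -- each division.
  refine le_of_tendsto_of_tendsto' (HasKurzweilIntegral.tendsto hI).norm
    (HasKurzweilIntegral.tendsto hM) fun P => ?_
  refine (norm_sum_le _ _).trans (Finset.sum_le_sum fun j hj => ?_)
  have hj := Finset.mem_range.1 hj
  have h1 := hV _ (P.pt_mem hj.le) _ (P.pt_mem hj) (P.pt_le_succ hj)
  rw [← sub_smul, ← sub_smul, norm_smul, smul_eq_mul, Real.norm_eq_abs]
  exact mul_le_mul h1 (hg _ (P.tag_mem_Icc hj)) (norm_nonneg _) ((abs_nonneg _).trans h1)

/-- The indefinite integral is left-continuous where the integrator is. -/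
lemma KSIntegrable.tendsto_left [CompleteSpace E] (H : KSIntegrable g h a b) {t : ℝ} (hat : a < t)
    (htb : t ≤ b) (hh : Tendsto h (𝓝[<] t) (𝓝 (h t))) :
    Tendsto (ksIntegral g h a) (𝓝[<] t) (𝓝 (ksIntegral g h a t)) := by
  have h1 := HasKurzweilIntegral.tendsto_left (U := fun τ t => h t • g τ) (G := ksIntegral g h a)
    hat fun s hs => (H.mono le_rfl hs.1 (hs.2.trans htb)).hasKSIntegral
  have h2 : Tendsto (fun s => h t • g t - h s • g t) (𝓝[<] t) (𝓝 0) := by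
    simpa using (hh.smul_const (g t)).const_sub (h t • g t)
  simpa using h1.sub h2

/-- The right jump of the indefinite integral at the lower end point. -/
lemma KSIntegrable.tendsto_right [CompleteSpace E] (H : KSIntegrable g h a b) (hab : a < b) {e : ℝ}
    (hh : HasRightJump h a e) : Tendsto (ksIntegral g h a) (𝓝[>] a) (𝓝 (e • g a)) := by
  have h1 := HasKurzweilIntegral.tendsto_right (U := fun τ t => h t • g τ) (G := ksIntegral g h a)
    hab fun s hs => (H.mono le_rfl hs.1 hs.2).hasKSIntegral
  have h2 := h1.add (Tendsto.smul_const hh (g a))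
  simpa [sub_smul] using h2

end KurzweilStieltjes

/-! ### Functions of bounded variation -/

section BoundedVariation

variable {E : Type*} [NormedAddCommGroup E] {a b : ℝ}

/-- The bound forces `M` to be monotone, and a monotone function has finite variation on a compact
interval. In the application `M` is a dominating indefinite integral. -/
lemma BoundedVariationOn.of_norm_sub_le {f : ℝ → E} {M : ℝ → ℝ}
    (hM : ∀ s ∈ Icc a b, ∀ t ∈ Icc a b, s ≤ t → ‖f t - f s‖ ≤ M t - M s) :
    BoundedVariationOn f (Icc a b) := by
  rcases lt_or_ge b a with hab | hab
  · exact BoundedVariationOn.of_subsingleton (by simp [Icc_eq_empty hab.not_ge])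
  have hmono : MonotoneOn M (Icc a b) := fun s hs t ht hst =>
    sub_nonneg.1 ((norm_nonneg _).trans (hM s hs t ht hst))
  have hle : eVariationOn f (Icc a b) ≤ eVariationOn M (Icc a b) := by
    refine iSup_mono fun p => Finset.sum_le_sum fun i _ => ?_
    have h := hM _ (p.2.2.2 i) _ (p.2.2.2 (i + 1)) (p.2.2.1 (Nat.le_succ i))
    rw [edist_dist, edist_dist, dist_eq_norm, Real.dist_eq]
    exact ENNReal.ofReal_le_ofReal (h.trans (le_abs_self _))
  refine ne_top_of_le_ne_top ?_ hle
  rw [← inter_self (Icc a b)]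
  exact hmono.locallyBoundedVariationOn a b (left_mem_Icc.2 hab) (right_mem_Icc.2 hab)

lemma BoundedVariationOn.add {f₁ f₂ : ℝ → E} {s : Set ℝ} (h₁ : BoundedVariationOn f₁ s)
    (h₂ : BoundedVariationOn f₂ s) : BoundedVariationOn (fun t => f₁ t + f₂ t) s := by
  refine ne_top_of_le_ne_top (ENNReal.add_ne_top.2 ⟨h₁, h₂⟩) (iSup_le fun p => ?_)
  refine le_trans (Finset.sum_le_sum fun i _ => edist_add_add_le _ _ _ _) ?_
  rw [Finset.sum_add_distrib]
  exact add_le_add (eVariationOn.sum_le p.2.2.1 p.2.2.2) (eVariationOn.sum_le p.2.2.1 p.2.2.2)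

lemma boundedVariationOn_const (c : E) (s : Set ℝ) : BoundedVariationOn (fun _ => c) s := by
  have h : eVariationOn (fun _ : ℝ => c) s = 0 :=
    eVariationOn.constant_on (subsingleton_singleton.anti (by rintro _ ⟨_, _, rfl⟩; rfl))
  rw [BoundedVariationOn, h]
  exact ENNReal.zero_ne_top

lemma BoundedVariationOn.eval {n : ℕ} {u : ℝ → Vec n} {s : Set ℝ} (hu : BoundedVariationOn u s)
    (i : Fin n) : BoundedVariationOn (fun t => u t i) s :=
  (LipschitzWith.eval (α := fun _ => ℝ) i).lipschitzOnWith.comp_boundedVariationOn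
    (mapsTo_univ u s) hu

lemma BoundedVariationOn.exists_sub_monotoneOn {f : ℝ → ℝ} (hf : BoundedVariationOn f (Icc a b)) :
    ∃ p q : ℝ → ℝ, MonotoneOn p (Icc a b) ∧ MonotoneOn q (Icc a b) ∧ f = p - q :=
  hf.locallyBoundedVariationOn.exists_monotoneOn_sub_monotoneOn

lemma BoundedVariationOn.integrableOn {n : ℕ} {u : ℝ → Vec n}
    (hu : BoundedVariationOn u (Icc a b)) : IntegrableOn u (Icc a b) := by
  refine Integrable.of_eval fun i => ?_
  obtain ⟨p, q, hp, hq, hpq⟩ := (hu.eval i).exists_sub_monotoneOn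
  rw [hpq]
  exact (hp.integrableOn_isCompact isCompact_Icc).sub (hq.integrableOn_isCompact isCompact_Icc)

/-- Nothing is known about `u` off `[a, b]`. Composition with the projection makes the monotone
parts monotone on all of `ℝ`, hence Borel, and keeps the values in `u '' Icc a b`; superposition
needs both properties globally. -/
lemma BoundedVariationOn.measurable_projIcc {n : ℕ} {u : ℝ → Vec n} (hab : a ≤ b)
    (hu : BoundedVariationOn u (Icc a b)) : Measurable fun t => u (projIcc a b hab t) := by
  refine measurable_pi_iff.2 fun i => ?_
  obtain ⟨p, q, hp, hq, hpq⟩ := (hu.eval i).exists_sub_monotoneOn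
  have key : ∀ r : ℝ → ℝ, MonotoneOn r (Icc a b) → Measurable fun t => r (projIcc a b hab t) :=
    fun r hr => Monotone.measurable fun s t hst =>
      hr (projIcc a b hab s).2 (projIcc a b hab t).2 (monotone_projIcc hab hst)
  have h1 : (fun t => u (projIcc a b hab t) i)
      = fun t => p (projIcc a b hab t) - q (projIcc a b hab t) :=
    funext fun t => congrFun hpq (projIcc a b hab t : ℝ)
  rw [h1]
  exact (key p hp).sub (key q hq)

lemma abs_sub_le_varFrom_sub {h : ℝ → ℝ} (hh : BoundedVariationOn h (Icc a b)) {s t : ℝ}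
    (hs : s ∈ Icc a b) (ht : t ∈ Icc a b) (hst : s ≤ t) :
    |h t - h s| ≤ varFrom h a t - varFrom h a s := by
  have hadd := eVariationOn.Icc_add_Icc h (s := univ) hs.1 hst (mem_univ s)
  simp only [univ_inter] at hadd
  have h1 : eVariationOn h (Icc a s) ≠ ⊤ := hh.mono (Icc_subset_Icc_right hs.2)
  have h2 : eVariationOn h (Icc s t) ≠ ⊤ := hh.mono (Icc_subset_Icc hs.1 ht.2)
  have h3 := BoundedVariationOn.dist_le h2 (right_mem_Icc.2 hst) (left_mem_Icc.2 hst)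
  rw [varFrom, varFrom, ← hadd, ENNReal.toReal_add h1 h2, add_sub_cancel_left, ← Real.dist_eq]
  exact h3

/-- An increment of the indefinite integral is the integral over `[s, t]`, dominated there by `∫ m
dV`. It is used with `V` the identity for the `f` term and `V` the variation of `h` for the `g`
term. -/
lemma boundedVariationOn_ksIntegral [NormedSpace ℝ E] [CompleteSpace E] {g : ℝ → E}
    {h m V : ℝ → ℝ} (H : KSIntegrable g h a b) (HM : KSIntegrable m V a b)
    (hg : ∀ t ∈ Icc a b, ‖g t‖ ≤ m t)
    (hV : ∀ s ∈ Icc a b, ∀ t ∈ Icc a b, s ≤ t → |h t - h s| ≤ V t - V s) :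
    BoundedVariationOn (ksIntegral g h a) (Icc a b) := by
  refine BoundedVariationOn.of_norm_sub_le (M := ksIntegral m V a) fun s hs t ht hst => ?_
  have hsub : Icc s t ⊆ Icc a b := Icc_subset_Icc hs.1 ht.2
  rw [ksIntegral_add (H.mono le_rfl ht.1 ht.2) hs.1 hst,
    ksIntegral_add (HM.mono le_rfl ht.1 ht.2) hs.1 hst, add_sub_cancel_left, add_sub_cancel_left]
  exact (H.mono hs.1 hst ht.2).hasKSIntegral.norm_le (HM.mono hs.1 hst ht.2).hasKSIntegral
    (fun r hr => hg r (hsub hr)) fun r hr r' hr' => hV r (hsub hr) r' (hsub hr')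

end BoundedVariation

/-! ### Lebesgue integrable functions are Kurzweil integrable -/

section Lebesgue

variable {a b : ℝ}

open TaggedDivision

/-- One half of the comparison of Riemann sums with the Lebesgue integral. -/
lemma eventually_kurzweilSum_lt {f : ℝ → ℝ} (hab : a ≤ b) (hf : IntegrableOn f (Icc a b)) {ε : ℝ}
    (hε : 0 < ε) :
    ∀ᶠ P in fineFilter a b, P.kurzweilSum (fun τ t => t • f τ) < (∫ t in a..b, f t) + ε := by
  -- The error is at most `η` from the integral of the majorant `g` and `(b - a) * η` from the
  -- cells. The summand `2` leaves room and keeps the denominator positive when `a = b`.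
  set η := ε / (b - a + 2) with hη_def
  have hη : 0 < η := div_pos hε (by linarith)
  obtain ⟨g, hfg, hg_lsc, hg_int, hg_top, hg⟩ := exists_lt_lowerSemicontinuous_integral_lt f hf hη
  -- Lower semicontinuity of the majorant (Vitali–Carathéodory) supplies the gauge: near `τ`, `g`
  -- stays above `f τ - η`.
  have hnhds : ∀ τ, ∃ d > 0, ∀ t ∈ Ioo (τ - d) (τ + d), ((f τ - η : ℝ) : EReal) < g t := fun τ => by
    have h1 : ((f τ - η : ℝ) : EReal) < g τ :=
      lt_of_le_of_lt (EReal.coe_le_coe_iff.2 (by linarith)) (hfg τ)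
    obtain ⟨d, hd, H⟩ := Metric.eventually_nhds_iff_ball.1 (hg_lsc τ _ h1)
    exact ⟨d, hd, fun t ht => H t (by rwa [Real.ball_eq_Ioo])⟩
  choose δ hδ hδg using hnhds
  filter_upwards [(hasBasis_fineFilter a b).mem_of_mem fun t _ => hδ t] with P hP
  have hgI : IntervalIntegrable (fun t => (g t).toReal) volume a b :=
    (intervalIntegrable_iff_integrableOn_Icc_of_le hab).2 hg_int
  have hGI : IntervalIntegrable (fun t => (g t).toReal + η) volume a b :=
    hgI.add intervalIntegrable_const
  have hsub : ∀ j < P.size, Icc (P.pt j) (P.pt (j + 1)) ⊆ Icc a b := fun j hj =>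
    Icc_subset_Icc (P.left_le_pt hj.le) (P.pt_le_right hj)
  have hGj : ∀ j < P.size,
      IntervalIntegrable (fun t => (g t).toReal + η) volume (P.pt j) (P.pt (j + 1)) :=
    fun j hj => hGI.mono_set (by
      rw [uIcc_of_le hab, uIcc_of_le (P.pt_le_succ hj)]
      exact hsub j hj)
  have hsum : P.kurzweilSum (fun τ t => t • f τ) ≤ ∫ t in a..b, ((g t).toReal + η) := by
    have h0 := intervalIntegral.sum_integral_adjacent_intervals (μ := volume) hGj
    rw [P.pt_zero, P.pt_size] at h0
    rw [← h0]
    refine Finset.sum_le_sum fun j hj => ?_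
    have hj := Finset.mem_range.1 hj
    have hle := P.pt_le_succ hj
    have h1 : (∫ _ in P.pt j..P.pt (j + 1), f (P.tag j))
        = P.pt (j + 1) • f (P.tag j) - P.pt j • f (P.tag j) := by
      rw [intervalIntegral.integral_const, sub_smul]
    rw [← h1]
    refine intervalIntegral.integral_mono_ae_restrict hle intervalIntegrable_const (hGj j hj) ?_
    filter_upwards [ae_restrict_of_ae_restrict_of_subset (hsub j hj) hg_top,
      ae_restrict_mem measurableSet_Icc] with t ht ht'
    have h2 := hδg _ t (hP j hj ht')
    have h3 : f (P.tag j) - η ≤ (g t).toReal := by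
      have := EReal.toReal_le_toReal h2.le (EReal.coe_ne_bot _) ht.ne
      rwa [EReal.toReal_coe] at this
    linarith
  have hval : ∫ t in a..b, ((g t).toReal + η) = (∫ t in Icc a b, (g t).toReal) + (b - a) * η := by
    rw [intervalIntegral.integral_add hgI intervalIntegrable_const,
      intervalIntegral.integral_const, smul_eq_mul, intervalIntegral.integral_of_le hab,
      integral_Icc_eq_integral_Ioc]
  rw [hval] at hsum
  rw [intervalIntegral.integral_of_le hab, ← integral_Icc_eq_integral_Ioc]
  have h4 : (b - a + 2) * η = ε := mul_div_cancel₀ _ (by linarith)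
  linarith

/-- A Lebesgue integrable function is Kurzweil integrable, with the same integral. -/
lemma hasKSIntegral_id {f : ℝ → ℝ} (hab : a ≤ b) (hf : IntegrableOn f (Icc a b)) :
    HasKSIntegral f (fun t => t) a b (∫ t in a..b, f t) := by
  refine hasKurzweilIntegral_iff.2 ⟨hab, Metric.tendsto_nhds.2 fun ε hε => ?_⟩
  -- The lower estimate is the upper one for `-f`.
  filter_upwards [eventually_kurzweilSum_lt hab hf hε,
    eventually_kurzweilSum_lt (f := fun t => -f t) hab hf.neg hε] with P h1 h2
  have h3 : P.kurzweilSum (fun τ t => t • -f τ) = -P.kurzweilSum (fun τ t => t • f τ) := by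
    simp only [kurzweilSum, ← Finset.sum_neg_distrib]
    exact Finset.sum_congr rfl fun j _ => by simp only [smul_eq_mul]; ring
  rw [h3, intervalIntegral.integral_neg] at h2
  rw [Real.dist_eq, abs_lt]
  constructor <;> linarith

lemma hasKSIntegral_id_vec {n : ℕ} {f : ℝ → Vec n} (hab : a ≤ b)
    (hf : IntegrableOn f (Icc a b)) :
    HasKSIntegral f (fun t => t) a b (fun i => ∫ t in a..b, f t i) :=
  hasKSIntegral_pi hab fun i => hasKSIntegral_id hab (Integrable.eval hf i)

end Lebesgue

/-! ### Superposition -/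

/-- Carathéodory superposition: `t ↦ F (u t) t` is measurable if `F` is measurable in `t` and
continuous in the first variable. -/
lemma aestronglyMeasurable_superposition {n : ℕ} {Ω : Set (Vec n)} {F : Vec n → ℝ → Vec n}
    {S : Set ℝ} (hS : MeasurableSet S) {u : ℝ → Vec n} (hu : Measurable u) (huΩ : ∀ t, u t ∈ Ω)
    (hc : ∀ t ∈ S, ContinuousOn (fun y => F y t) Ω)
    (hm : ∀ y ∈ Ω, AEStronglyMeasurable (fun t => F y t) (volume.restrict S)) :
    AEStronglyMeasurable (fun t => F (u t) t) (volume.restrict S) := by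
  let A : ℕ → SimpleFunc ℝ (Vec n) := fun k => SimpleFunc.approxOn u hu Ω (u 0) (huΩ 0) k
  have hA : ∀ k t, A k t ∈ Ω := fun k t => SimpleFunc.approxOn_mem hu (huΩ 0) k t
  refine aestronglyMeasurable_of_tendsto_ae atTop (f := fun k t => F (A k t) t) (fun k => ?_) ?_
  -- On each of the finitely many level sets of the simple function, the first argument of `F` is
  -- frozen at a point of `Ω`.
  · have h1 : (fun t => F (A k t) t)
        = fun t => ∑ y ∈ (A k).range, ((A k) ⁻¹' {y}).indicator (fun t => F y t) t := by
      funext t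
      rw [Finset.sum_eq_single (A k t)]
      · rw [indicator_of_mem]; rfl
      · exact fun y _ hy => indicator_of_notMem
          (fun h : t ∈ A k ⁻¹' {y} => hy (mem_singleton_iff.1 h).symm) _
      · exact fun h => absurd ((A k).mem_range_self t) h
    rw [h1]
    refine Finset.aestronglyMeasurable_fun_sum _ fun y hy => ?_
    obtain ⟨t, rfl⟩ := SimpleFunc.mem_range.1 hy
    exact (hm _ (hA k t)).indicator ((A k).measurableSet_preimage _)
  · filter_upwards [ae_restrict_mem hS] with t ht
    have h1 : Tendsto (fun k => A k t) atTop (𝓝[Ω] (u t)) :=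
      tendsto_nhdsWithin_iff.2 ⟨SimpleFunc.tendsto_approxOn hu (huΩ 0) (subset_closure (huΩ t)),
        .of_forall fun k => hA k t⟩
    exact (hc t ht (u t) (huΩ t)).tendsto.comp h1

lemma norm_le_norm1 {n : ℕ} (v : Vec n) : ‖v‖ ≤ norm1 v :=
  (pi_norm_le_iff_of_nonneg (Finset.sum_nonneg fun _ _ => abs_nonneg _)).2 fun i =>
    Finset.single_le_sum (f := fun i => |v i|) (fun _ _ => abs_nonneg _) (Finset.mem_univ i)

lemma integrableOn_superposition {n : ℕ} {Ω : Set (Vec n)} {F : Vec n → ℝ → Vec n} {a b : ℝ}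
    (hab : a ≤ b) {u : ℝ → Vec n} (hu : BoundedVariationOn u (Icc a b))
    (huΩ : ∀ t ∈ Icc a b, u t ∈ Ω) (hc : ∀ t ∈ Icc a b, ContinuousOn (fun y => F y t) Ω)
    (hm : ∀ y ∈ Ω, AEStronglyMeasurable (fun t => F y t) (volume.restrict (Icc a b)))
    {m : ℝ → ℝ} (hmi : IntegrableOn m (Icc a b))
    (hb : ∀ y ∈ Ω, ∀ t ∈ Icc a b, norm1 (F y t) ≤ m t) :
    IntegrableOn (fun t => F (u t) t) (Icc a b) := by
  refine Integrable.mono' hmi ?_ ?_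
  · refine (aestronglyMeasurable_superposition measurableSet_Icc (hu.measurable_projIcc hab)
      (fun t => huΩ _ (projIcc a b hab t).2) hc hm).congr ?_
    filter_upwards [ae_restrict_mem measurableSet_Icc] with t ht
    rw [projIcc_of_mem hab ht]
  · filter_upwards [ae_restrict_mem measurableSet_Icc] with t ht
    exact (norm_le_norm1 _).trans (hb _ (huΩ t ht) t ht)

/-! ### Test functions -/

section TestFunctions

variable {T : ℝ}

lemma testSpace_apply_zero (φ : testSpace T) : (φ : ℝ → ℝ) 0 = 0 := by
  simpa using φ.2.2 0 0 (by simp)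

lemma testSpace_apply_right (φ : testSpace T) : (φ : ℝ → ℝ) T = 0 := by
  simpa using φ.2.2 0 T (by simp)

lemma continuous_deriv_testSpace (φ : testSpace T) : Continuous (deriv (φ : ℝ → ℝ)) :=
  (testDeriv T φ).2.1.continuous

lemma absolutelyContinuousOnInterval_testSpace (φ : testSpace T) :
    AbsolutelyContinuousOnInterval (φ : ℝ → ℝ) 0 T :=
  (φ.2.1.contDiffOn.of_le (by exact_mod_cast le_top)).absolutelyContinuousOnInterval

lemma setIntegral_Icc_eq_intervalIntegral (hT : 0 ≤ T) (u : ℝ → ℝ) :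
    ∫ t in Icc 0 T, u t = ∫ t in 0..T, u t := by
  rw [intervalIntegral.integral_of_le hT, integral_Icc_eq_integral_Ioc]

lemma setIntegral_deriv_testSpace (hT : 0 ≤ T) (φ : testSpace T) :
    ∫ t in Icc 0 T, deriv (φ : ℝ → ℝ) t = 0 := by
  rw [setIntegral_Icc_eq_intervalIntegral hT,
    (absolutelyContinuousOnInterval_testSpace φ).integral_deriv_eq_sub, testSpace_apply_zero,
    testSpace_apply_right, sub_zero]

/-- Integration by parts: the distributional derivative of a primitive. -/
lemma setIntegral_primitive_mul_deriv (hT : 0 ≤ T) {f : ℝ → ℝ} (hf : IntegrableOn f (Icc 0 T))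
    (φ : testSpace T) :
    ∫ t in Icc 0 T, (∫ r in 0..t, f r) * deriv (φ : ℝ → ℝ) t
      = -∫ t in Icc 0 T, f t * (φ : ℝ → ℝ) t := by
  have hf' : IntervalIntegrable f volume 0 T :=
    (intervalIntegrable_iff_integrableOn_Icc_of_le hT).2 hf
  have hF := hf'.absolutelyContinuousOnInterval_intervalIntegral (c := 0) left_mem_uIcc
  rw [setIntegral_Icc_eq_intervalIntegral hT, setIntegral_Icc_eq_intervalIntegral hT,
    hF.integral_mul_deriv_eq_deriv_mul (absolutelyContinuousOnInterval_testSpace φ),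
    testSpace_apply_zero, testSpace_apply_right, mul_zero, mul_zero, sub_zero, zero_sub]
  congr 1
  refine intervalIntegral.integral_congr_ae ?_
  filter_upwards [hf'.ae_hasDerivAt_integral] with t ht ht'
  rw [(ht (uIoc_subset_uIcc ht') 0 left_mem_uIcc).deriv]

/-- A smooth function with compact support in `(0, T)` and vanishing integral is the derivative of
a test function. -/
lemma exists_testSpace_deriv_eq (hT : 0 ≤ T) {θ : ℝ → ℝ} (hθ : ContDiff ℝ ∞ θ)
    (hsupp : tsupport θ ⊆ Ioo 0 T) (hint : ∫ t in Icc 0 T, θ t = 0) :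
    ∃ φ : testSpace T, deriv (φ : ℝ → ℝ) = θ := by
  have hc := hθ.continuous
  have hderiv : ∀ t, HasDerivAt (fun t => ∫ r in 0..t, θ r) (θ t) t := fun t =>
    intervalIntegral.integral_hasDerivAt_right (hc.intervalIntegrable _ _)
      (hc.stronglyMeasurableAtFilter _ _) hc.continuousAt
  have hd : deriv (fun t => ∫ r in 0..t, θ r) = θ := funext fun t => (hderiv t).deriv
  have hzero : ∀ t ∉ Ioo 0 T, θ t = 0 := fun t ht =>
    image_eq_zero_of_notMem_tsupport fun h => ht (hsupp h)
  have hprim : ∀ t ∉ Ioo 0 T, ∫ r in 0..t, θ r = 0 := fun t ht => by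
    -- To the left of `0` the integrand vanishes; to the right of `T` it is the zero mean of `θ`
    -- that is needed.
    rcases le_or_gt t 0 with h | h
    · refine intervalIntegral.integral_zero_ae (.of_forall fun r hr => hzero r fun hr' => ?_)
      rw [uIoc_of_ge h] at hr
      exact hr'.1.not_ge hr.2
    · have hTt : T ≤ t := not_lt.1 fun h' => ht ⟨h, h'⟩
      rw [← intervalIntegral.integral_add_adjacent_intervals (hc.intervalIntegrable 0 T)
        (hc.intervalIntegrable T t), ← setIntegral_Icc_eq_intervalIntegral hT, hint, zero_add]
      refine intervalIntegral.integral_zero_ae (.of_forall fun r hr => hzero r fun hr' => ?_)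
      rw [uIoc_of_le hTt] at hr
      exact hr'.2.not_gt hr.1
  refine ⟨⟨fun t => ∫ r in 0..t, θ r, contDiff_infty_iff_deriv.2
    ⟨fun t => (hderiv t).differentiableAt, hd.symm ▸ hθ⟩, fun j t ht => ?_⟩, hd⟩
  cases j with
  | zero => simpa using hprim t ht
  | succ j =>
    rw [iteratedDeriv_succ', hd]
    -- Off its closed support `θ` vanishes near `t`, which kills its derivatives at the end points
    -- too.
    have h1 : θ =ᶠ[𝓝 t] fun _ => 0 :=
      notMem_tsupport_iff_eventuallyEq.1 fun h => ht (hsupp h)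
    rw [h1.iteratedDeriv_eq, iteratedDeriv_const]
    simp

/-- The lemma of du Bois-Reymond. -/
theorem exists_ae_eq_const_of_integral_mul_deriv_eq_zero (hT : 0 < T) {u : ℝ → ℝ}
    (hu : IntegrableOn u (Icc 0 T))
    (H : ∀ φ : testSpace T, ∫ t in Icc 0 T, u t * deriv (φ : ℝ → ℝ) t = 0) :
    ∃ c, ∀ᵐ t ∂volume.restrict (Icc 0 T), t ∈ Ioo 0 T → u t = c := by
  -- The bump is supported in `[T/4, 3T/4]`.
  let B : ContDiffBump (T / 2) := ⟨T / 8, T / 4, by linarith, by linarith⟩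
  set ρ : ℝ → ℝ := B.normed volume with hρ_def
  have hρ : ContDiff ℝ ∞ ρ := B.contDiff_normed
  have hρs : tsupport ρ ⊆ Ioo 0 T := by
    rw [hρ_def, B.tsupport_normed_eq, Real.closedBall_eq_Icc]
    have hr : B.rOut = T / 4 := rfl
    rw [hr]
    exact fun t ht => ⟨by linarith [ht.1], by linarith [ht.2]⟩
  have hρi : ∫ t in Icc 0 T, ρ t = 1 := by
    rw [setIntegral_eq_integral_of_forall_compl_eq_zero, hρ_def, B.integral_normed]
    exact fun t ht => image_eq_zero_of_notMem_tsupport fun h => ht (Ioo_subset_Icc_self (hρs h))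
  have hmul : ∀ {ψ : ℝ → ℝ}, Continuous ψ → IntegrableOn (fun t => u t * ψ t) (Icc 0 T) :=
    fun hψ => hu.mul_continuousOn hψ.continuousOn isCompact_Icc
  have hcont : ∀ {ψ : ℝ → ℝ}, Continuous ψ → IntegrableOn ψ (Icc 0 T) :=
    fun hψ => hψ.continuousOn.integrableOn_compact isCompact_Icc
  -- Since `ψ - (∫ ψ) ρ` has mean zero it is a `φ'`, so testing `u` with it gives `∫ u ψ = (∫ ψ)(∫ u
  -- ρ)`. This forces the constant to be `∫ u ρ`.
  set c := ∫ t in Icc 0 T, u t * ρ t with hc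
  have hint : Integrable (fun t => u t - c) (volume.restrict (Icc 0 T)) :=
    hu.sub (integrable_const c)
  refine ⟨c, ?_⟩
  have key := isOpen_Ioo.ae_eq_zero_of_integral_contDiff_smul_eq_zero (U := Ioo 0 T)
    (hint.locallyIntegrable.locallyIntegrableOn _) fun ψ hψ _ hψs => by
      have h1 := hψ.continuous
      have h2 := hρ.continuous
      set k := ∫ t in Icc 0 T, ψ t with hk
      have hθi : ∫ t in Icc 0 T, (ψ t - k * ρ t) = 0 := by
        rw [integral_sub (hcont h1) ((hcont h2).const_mul k), integral_const_mul, hρi, mul_one,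
          sub_self]
      have hθs : tsupport (fun t => ψ t - k * ρ t) ⊆ Ioo 0 T :=
        (tsupport_sub _ _).trans (union_subset hψs
          ((tsupport_mul_subset_right (f := fun _ => k) (g := ρ)).trans hρs))
      obtain ⟨φ, hφ⟩ := exists_testSpace_deriv_eq hT.le (hψ.sub (contDiff_const.mul hρ)) hθs hθi
      have h3 := H φ
      rw [hφ] at h3
      have h4 : ∀ t, u t * (ψ t - k * ρ t) = u t * ψ t - k * (u t * ρ t) := fun t => by ring
      simp only [h4] at h3
      rw [integral_sub (hmul h1) ((hmul h2).const_mul k), integral_const_mul] at h3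
      have h5 : ∀ t, ψ t • (u t - c) = u t * ψ t - c * ψ t := fun t => by
        rw [smul_eq_mul]; ring
      simp only [h5]
      rw [integral_sub (hmul h1) ((hcont h1).const_mul c), integral_const_mul]
      linarith
  exact key.mono fun t ht ht' => sub_eq_zero.1 (ht ht')

/-- A left-continuous function which is a.e. constant is constant. -/
lemma IsLeftContinuousOn.eq_of_ae_eq {u : ℝ → ℝ} {c : ℝ}
    (hu : IsLeftContinuousOn u (Ioc 0 T))
    (hc : ∀ᵐ t ∂volume.restrict (Icc 0 T), t ∈ Ioo 0 T → u t = c) {t : ℝ} (ht : t ∈ Ioc 0 T) :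
    u t = c := by
  by_contra hne
  obtain ⟨l, hl, H⟩ := (mem_nhdsLT_iff_exists_Ioo_subset' ht.1).1
    ((hu t ht).eventually_ne hne)
  have hlt : max l 0 < t := max_lt hl ht.1
  have hsub : Ioo (max l 0) t ⊆ Ioo 0 T :=
    Ioo_subset_Ioo (le_max_right _ _) ht.2
  have h1 := ae_restrict_of_ae_restrict_of_subset (hsub.trans Ioo_subset_Icc_self) hc
  -- Just to the left of `t`, left-continuity gives `u ≠ c` everywhere, against `u = c` almost
  -- everywhere; the interval would be null.
  have h2 : ∀ᵐ s ∂volume.restrict (Ioo (max l 0) t), False := by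
    filter_upwards [h1, ae_restrict_mem measurableSet_Ioo] with s hs hs'
    exact H ⟨(le_max_left _ _).trans_lt hs'.1, hs'.2⟩ (hs (hsub hs'))
  have h3 : volume (Ioo (max l 0) t) = 0 :=
    Measure.restrict_eq_zero.1 (ae_eq_bot.1 (eventually_false_iff_eq_bot.1 h2))
  rw [Real.volume_Ioo, ENNReal.ofReal_eq_zero] at h3
  linarith

end TestFunctions

/-! ### Distributions of functions -/

section Distributions

variable {n : ℕ} {T : ℝ}

lemma pairing_distOfFun {u : ℝ → Vec n} (hu : IsL1 T u) (φ : VecTest n T) :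
    pairing (distOfFun u hu) φ = ∑ i, ∫ t in Icc 0 T, u t i * (φ i : ℝ → ℝ) t :=
  integral_finsetSum _ fun i _ => integrableOn_coord_mul hu i (φ i).2.1.continuous

lemma pairing_distDeriv_distOfFun {u : ℝ → Vec n} (hu : IsL1 T u) (φ : VecTest n T) :
    pairing (distDeriv (distOfFun u hu)) φ
      = -∑ i, ∫ t in Icc 0 T, u t i * deriv (φ i : ℝ → ℝ) t := by
  rw [← show pairing (distOfFun u hu) (vecTestDeriv n T φ)
    = ∑ i, ∫ t in Icc 0 T, u t i * deriv (φ i : ℝ → ℝ) t from pairing_distOfFun hu _]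
  rfl

/-- `Du = f + Dv` says that the distributional derivative of `u - ∫ f - v` vanishes. -/
lemma distDeriv_eq_add_iff (hT : 0 ≤ T) {u f v : ℝ → Vec n} (hu : IsL1 T u) (hf : IsL1 T f)
    (hv : IsL1 T v) :
    (∀ φ : VecTest n T, pairing (distDeriv (distOfFun u hu)) φ
        = pairing (distOfFun f hf) φ + pairing (distDeriv (distOfFun v hv)) φ) ↔
      ∀ (i : Fin n) (φ : testSpace T),
        ∫ t in Icc 0 T, (u t i - (∫ r in 0..t, f r i) - v t i) * deriv (φ : ℝ → ℝ) t = 0 := by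
  -- Integration by parts replaces `f` by its primitive, with a change of sign, so that every term
  -- is tested with `φ'`.
  have key : ∀ (i : Fin n) (φ : testSpace T),
      ∫ t in Icc 0 T, (u t i - (∫ r in 0..t, f r i) - v t i) * deriv (φ : ℝ → ℝ) t
        = (∫ t in Icc 0 T, u t i * deriv (φ : ℝ → ℝ) t)
          + (∫ t in Icc 0 T, f t i * (φ : ℝ → ℝ) t)
          - ∫ t in Icc 0 T, v t i * deriv (φ : ℝ → ℝ) t := fun i φ => by
    have hd := continuous_deriv_testSpace φ
    have hfi : IntegrableOn (fun t => f t i) (Icc 0 T) := Integrable.eval hf i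
    have hF : IntegrableOn (fun t => (∫ r in 0..t, f r i) * deriv (φ : ℝ → ℝ) t) (Icc 0 T) := by
      have h1 := ((intervalIntegrable_iff_integrableOn_Icc_of_le hT).2
        hfi).absolutelyContinuousOnInterval_intervalIntegral (c := 0) left_mem_uIcc
      have h2 := h1.continuousOn
      rw [uIcc_of_le hT] at h2
      exact (h2.mul hd.continuousOn).integrableOn_compact isCompact_Icc
    simp only [sub_mul]
    have huF : IntegrableOn (fun t => u t i * deriv (φ : ℝ → ℝ) t
        - (∫ r in 0..t, f r i) * deriv (φ : ℝ → ℝ) t) (Icc 0 T) :=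
      (integrableOn_coord_mul hu i hd).sub hF
    rw [integral_sub huF (integrableOn_coord_mul hv i hd),
      integral_sub (integrableOn_coord_mul hu i hd) hF, setIntegral_primitive_mul_deriv hT hfi]
    ring
  simp only [pairing_distDeriv_distOfFun, pairing_distOfFun]
  constructor
  · intro H i φ
    -- A test vector with one nonzero component isolates the `i`-th equation.
    have h1 := H (Pi.single i φ)
    rw [Finset.sum_eq_single i, Finset.sum_eq_single i, Finset.sum_eq_single i] at h1
    · rw [Pi.single_eq_same] at h1
      rw [key]
      linarith
    all_goals first
      | exact fun h => absurd (Finset.mem_univ i) h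
      | exact fun j _ hj => by
          have h0 : deriv (0 : ℝ → ℝ) = 0 := funext fun t => deriv_const t 0
          rw [Pi.single_eq_of_ne hj]
          simp [h0]
  · intro H φ
    have h1 : ∑ i, ((∫ t in Icc 0 T, u t i * deriv (φ i : ℝ → ℝ) t)
          + (∫ t in Icc 0 T, f t i * (φ i : ℝ → ℝ) t)
          - ∫ t in Icc 0 T, v t i * deriv (φ i : ℝ → ℝ) t) = 0 :=
      Finset.sum_eq_zero fun i _ => by rw [← key, H]
    rw [Finset.sum_sub_distrib, Finset.sum_add_distrib] at h1
    linarith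

end Distributions

/-! ### The two notions of solution -/

section Equations

variable {n : ℕ} {T : ℝ} {Ω : Set (Vec n)} {f : ℝ → Vec n → ℝ → Vec n} {g : Vec n → ℝ → Vec n}
  {h : ℝ → ℝ} {lam : ℝ} {x : ℝ → Vec n}

lemma hasRightJump_id (t : ℝ) : HasRightJump (fun r : ℝ => r) t 0 := by
  have h1 : Tendsto (fun s : ℝ => s - t) (𝓝 t) (𝓝 (t - t)) :=
    (continuous_id.sub continuous_const).tendsto t
  rw [sub_self] at h1
  exact h1.mono_left nhdsWithin_le_nhds

lemma exists_hasRightJump (hT : 0 < T) (hh : BoundedVariationOn h (Icc 0 T)) :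
    ∃ d, HasRightJump h 0 d := by
  obtain ⟨l, hl⟩ := hh.exists_tendsto_right 0
  have h1 : Icc 0 T ∩ Ioi 0 = Ioc (0 : ℝ) T := by
    ext t
    exact ⟨fun ht => ⟨ht.2, ht.1.2⟩, fun ht => ⟨⟨ht.1.le, ht.2⟩, ht.1⟩⟩
  rw [h1, nhdsWithin_Ioc_eq_nhdsGT hT] at hl
  exact ⟨l - h 0, hl.sub_const _⟩

lemma ksIntegral_id_apply {u : ℝ → Vec n} (hu : IsL1 T u) {t : ℝ} (ht : t ∈ Icc 0 T) (i : Fin n) :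
    ksIntegral u (fun r => r) 0 t i = ∫ r in 0..t, u r i :=
  congrFun (hasKSIntegral_id_vec ht.1 (IntegrableOn.mono_set hu
    (Icc_subset_Icc_right ht.2))).ksIntegral_eq i

/-- Solutions of the integral equation up to their value at `0`, in terms of indefinite
integrals. -/
lemma stieltjesEquationAt_of_sub_eq
    (hf : KSIntegrable (fun r => f lam (x r) r) (fun r => r) 0 T)
    (hg : KSIntegrable (fun r => g (x r) r) h 0 T) {s t : ℝ} (hs : 0 ≤ s) (hst : s ≤ t)
    (htT : t ≤ T)
    (H : x t - ksIntegral (fun r => f lam (x r) r) (fun r => r) 0 t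
        - ksIntegral (fun r => g (x r) r) h 0 t
      = x s - ksIntegral (fun r => f lam (x r) r) (fun r => r) 0 s
        - ksIntegral (fun r => g (x r) r) h 0 s) :
    StieltjesEquationAt f g h lam x s t := by
  refine ⟨hf.mono hs hst htT, hg.mono hs hst htT, ?_⟩
  rw [ksIntegral_add (hf.mono le_rfl (hs.trans hst) htT) hs hst,
    ksIntegral_add (hg.mono le_rfl (hs.trans hst) htT) hs hst] at H
  rw [← sub_eq_zero] at H ⊢
  rw [← H]
  abel

/-- For a solution of the measure differential equation, `x - ∫₀ f - ∫₀ g dh` is constant on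
`(0, T]`. -/
lemma IsMDESolution.exists_sub_eq (hT : 0 < T) (hh : IsLeftContinuousOn h (Iic T))
    (H : IsMDESolution T Ω f g h lam x) :
    KSIntegrable (fun r => f lam (x r) r) (fun r => r) 0 T ∧
      KSIntegrable (fun r => g (x r) r) h 0 T ∧
      ∃ c, ∀ t ∈ Ioc 0 T, x t - ksIntegral (fun r => f lam (x r) r) (fun r => r) 0 t
        - ksIntegral (fun r => g (x r) r) h 0 t = c := by
  obtain ⟨-, hleft, -, P, hx, hf, ⟨hg, hG, rfl⟩, heq⟩ := H
  have hfK : KSIntegrable (fun r => f lam (x r) r) (fun r => r) 0 T :=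
    ⟨_, hasKSIntegral_id_vec hT.le hf⟩
  refine ⟨hfK, hg, ?_⟩
  have hzero := (distDeriv_eq_add_iff hT.le hx hf hG).1 heq
  set w : ℝ → Vec n := fun t => x t - ksIntegral (fun r => f lam (x r) r) (fun r => r) 0 t
    - ksIntegral (fun r => g (x r) r) h 0 t with hw
  have hwleft : IsLeftContinuousOn w (Ioc 0 T) := fun t ht =>
    ((hleft t ht).sub (hfK.tendsto_left ht.1 ht.2 (tendsto_id.mono_left nhdsWithin_le_nhds))).sub
      (hg.tendsto_left ht.1 ht.2 (hh t ht.2))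
  have hwi : ∀ i, ∀ t ∈ Icc 0 T, w t i
      = x t i - (∫ r in 0..t, f lam (x r) r i) - ksIntegral (fun r => g (x r) r) h 0 t i :=
    fun i t ht => by rw [← ksIntegral_id_apply hf ht]; rfl
  have hwc : ∀ i, ∃ c, ∀ t ∈ Ioc 0 T, w t i = c := fun i => by
    have hFi : IntegrableOn (fun t => ∫ r in 0..t, f lam (x r) r i) (Icc 0 T) := by
      have h1 := ((intervalIntegrable_iff_integrableOn_Icc_of_le hT.le).2
        (Integrable.eval hf i)).absolutelyContinuousOnInterval_intervalIntegral
          (c := 0) left_mem_uIcc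
      have h2 := h1.continuousOn
      rw [uIcc_of_le hT.le] at h2
      exact h2.integrableOn_compact isCompact_Icc
    have hint : IntegrableOn (fun t => w t i) (Icc 0 T) :=
      (((Integrable.eval hx i).sub hFi).sub (Integrable.eval hG i)).congr (by
        filter_upwards [ae_restrict_mem measurableSet_Icc] with t ht
        exact (hwi i t ht).symm)
    obtain ⟨c, hc⟩ := exists_ae_eq_const_of_integral_mul_deriv_eq_zero hT hint fun φ => by
      refine Eq.trans (setIntegral_congr_fun measurableSet_Icc fun t ht => ?_) (hzero i φ)
      simp only [hwi i t ht]
    exact ⟨c, fun t ht => IsLeftContinuousOn.eq_of_ae_eq (u := fun t => w t i)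
      (fun s hs => tendsto_pi_nhds.1 (hwleft s hs) i) hc ht⟩
  choose c hc using hwc
  exact ⟨c, fun t ht => funext fun i => hc i t ht⟩

lemma IsMDESolution.stieltjesEquationAt (hT : 0 < T) (hh : IsLeftContinuousOn h (Iic T))
    (H : IsMDESolution T Ω f g h lam x) {s t : ℝ} (hs : 0 < s) (hst : s ≤ t) (ht : t ≤ T) :
    StieltjesEquationAt f g h lam x s t := by
  obtain ⟨hf, hg, c, hc⟩ := H.exists_sub_eq hT hh
  exact stieltjesEquationAt_of_sub_eq hf hg hs.le hst ht
    ((hc t ⟨hs.trans_le hst, ht⟩).trans (hc s ⟨hs, hst.trans ht⟩).symm)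

/-- The constant value on `(0, T]` is the right limit at `0`, and the jump condition identifies it
with `x 0`. -/
lemma IsMDESolution.isSIESolution (hT : 0 < T) (hh : IsLeftContinuousOn h (Iic T))
    (H : IsMDESolution T Ω f g h lam x) {d : ℝ} (hd : HasRightJump h 0 d)
    (hx : HasRightJump x 0 (d • g (x 0) 0)) : IsSIESolution T Ω f g h lam x := by
  obtain ⟨hf, hg, c, hc⟩ := H.exists_sub_eq hT hh
  -- The jumps of `x` and of `∫ g dh` at `0` are the same and cancel; `∫ f ds` has none.
  have h1 := (Tendsto.sub hx (hf.tendsto_right hT (hasRightJump_id 0))).sub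
    (hg.tendsto_right hT hd)
  have h2 : Tendsto (fun s => x s - x 0 - ksIntegral (fun r => f lam (x r) r) (fun r => r) 0 s
      - ksIntegral (fun r => g (x r) r) h 0 s) (𝓝[>] 0) (𝓝 (c - x 0)) := by
    refine tendsto_const_nhds.congr' ?_
    filter_upwards [Ioc_mem_nhdsGT hT] with s hs
    rw [← hc s hs]
    abel
  have hc0 : x 0 = c := by
    have h3 := tendsto_nhds_unique h2 h1
    simp only [zero_smul, sub_zero, sub_self] at h3
    exact (sub_eq_zero.1 h3).symm
  refine ⟨H.2.2.1, fun t ht => stieltjesEquationAt_of_sub_eq hf hg le_rfl ht.1 ht.2 ?_⟩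
  rcases ht.1.eq_or_lt with rfl | h0
  · rfl
  · rw [hc t ⟨h0, ht.2⟩, ksIntegral_self, ksIntegral_self, sub_zero, sub_zero, hc0]

/-- Bounded variation of `x` has to come first: existence of the Kurzweil integral of `f(λ,x(·),·)`
alone does not give Lebesgue integrability, which is obtained from the superposition argument. -/
lemma IsSIESolution.isMDESolution (hT : 0 < T) (hh_left : IsLeftContinuousOn h (Iic T))
    (hh_bv : BoundedVariationOn h (Icc 0 T))
    (hf_cont : ∀ t ∈ Icc 0 T, ContinuousOn (fun y => f lam y t) Ω)
    (hf_meas : ∀ y ∈ Ω, AEStronglyMeasurable (fun t => f lam y t) (volume.restrict (Icc 0 T)))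
    {m : ℝ → ℝ} (hm : IntegrableOn m (Icc 0 T))
    (hfm : ∀ y ∈ Ω, ∀ t ∈ Icc 0 T, norm1 (f lam y t) ≤ m t)
    {m' : ℝ → ℝ} (hm' : KSIntegrable m' (fun t => varFrom h 0 t) 0 T)
    (hgm : ∀ y ∈ Ω, ∀ t ∈ Icc 0 T, norm1 (g y t) ≤ m' t)
    (H : IsSIESolution T Ω f g h lam x) :
    IsMDESolution T Ω f g h lam x ∧
      ∃ d : ℝ, HasRightJump h 0 d ∧ HasRightJump x 0 (d • g (x 0) 0) := by
  obtain ⟨hΩ, heq⟩ := H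
  obtain ⟨hf, hg, -⟩ := heq T (right_mem_Icc.2 hT.le)
  set F := ksIntegral (fun r => f lam (x r) r) (fun r => r) 0 with hF
  set G := ksIntegral (fun r => g (x r) r) h 0 with hG
  have hxeq : EqOn x (fun t => x 0 + F t + G t) (Icc 0 T) := fun t ht => (heq t ht).2.2
  have hFbv : BoundedVariationOn F (Icc 0 T) :=
    boundedVariationOn_ksIntegral hf ⟨_, hasKSIntegral_id hT.le hm⟩
      (fun t ht => (norm_le_norm1 _).trans (hfm _ (hΩ t ht) t ht))
      fun s _ t _ hst => (abs_of_nonneg (sub_nonneg.2 hst)).le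
  have hGbv : BoundedVariationOn G (Icc 0 T) :=
    boundedVariationOn_ksIntegral hg hm'
      (fun t ht => (norm_le_norm1 _).trans (hgm _ (hΩ t ht) t ht))
      fun s hs t ht hst => abs_sub_le_varFrom_sub hh_bv hs ht hst
  have hxbv : BoundedVariationOn x (Icc 0 T) := by
    rw [BoundedVariationOn, eVariationOn.congr hxeq]
    exact ((boundedVariationOn_const (x 0) _).add hFbv).add hGbv
  have hfL1 : IsL1 T (fun t => f lam (x t) t) :=
    integrableOn_superposition (F := f lam) hT.le hxbv hΩ hf_cont hf_meas hm hfm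
  refine ⟨⟨hxbv, fun t ht => ?_, hΩ, distDeriv (distOfFun G hGbv.integrableOn),
    hxbv.integrableOn, hfL1, ⟨hg, hGbv.integrableOn, rfl⟩, ?_⟩, ?_⟩
  · have h1 := ((hf.tendsto_left ht.1 ht.2
      (tendsto_id.mono_left nhdsWithin_le_nhds)).const_add (x 0)).add
        (hg.tendsto_left ht.1 ht.2 (hh_left t ht.2))
    rw [hxeq (Ioc_subset_Icc_self ht)]
    refine h1.congr' ?_
    filter_upwards [Ioo_mem_nhdsLT (a := (0 : ℝ)) ht.1] with s hs
    exact (hxeq ⟨hs.1.le, hs.2.le.trans ht.2⟩).symm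
  · refine (distDeriv_eq_add_iff hT.le hxbv.integrableOn hfL1 hGbv.integrableOn).2 fun i φ => ?_
    -- The difference of `x` and the two indefinite integrals is the constant `x 0`, which is
    -- orthogonal to every `φ'`.
    have h1 : ∫ t in Icc 0 T, x 0 i * deriv (φ : ℝ → ℝ) t = 0 := by
      rw [integral_const_mul, setIntegral_deriv_testSpace hT.le, mul_zero]
    refine Eq.trans (setIntegral_congr_fun measurableSet_Icc fun t ht => ?_) h1
    have h2 : x t i = x 0 i + F t i + G t i := congrFun (hxeq ht) i
    simp only [← ksIntegral_id_apply hfL1 ht]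
    rw [h2]
    ring
  · obtain ⟨d, hd⟩ := exists_hasRightJump hT hh_bv
    refine ⟨d, hd, ?_⟩
    have h1 := (hf.tendsto_right hT (hasRightJump_id 0)).add (hg.tendsto_right hT hd)
    rw [zero_smul, zero_add] at h1
    refine Tendsto.congr' ?_ h1
    filter_upwards [Ioc_mem_nhdsGT hT] with s hs
    have hxs : x s = x 0 + F s + G s := hxeq (Ioc_subset_Icc_self hs)
    rw [hxs, add_assoc, add_sub_cancel_left]

end Equations

theorem mainTheorem8 (n : ℕ) (T : ℝ) (hT : 0 < T)
    (Ω : Set (Vec n)) (hΩ : IsOpen Ω) (Λ : Set ℝ) (hΛ : IsOpen Λ)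
    (f : ℝ → Vec n → ℝ → Vec n) (g : Vec n → ℝ → Vec n) (h : ℝ → ℝ)
    (hh_left : IsLeftContinuousOn h (Iic T)) (hh_bv : BoundedVariationOn h (Icc 0 T))
    (hh_neg : ∀ t < 0, h t = h 0)
    (hf_cont : ∀ lam ∈ Λ, ∀ t ∈ Icc 0 T, ContinuousOn (fun y => f lam y t) Ω)
    (hf_meas : ∀ lam ∈ Λ, ∀ y ∈ Ω,
      AEStronglyMeasurable (fun t => f lam y t) (volume.restrict (Icc 0 T)))
    (hf_bound : ∃ m : ℝ → ℝ, (∀ t ∈ Icc 0 T, 0 ≤ m t) ∧ IntegrableOn m (Icc 0 T) ∧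
      ∀ lam ∈ Λ, ∀ y ∈ Ω, ∀ t ∈ Icc 0 T, norm1 (f lam y t) ≤ m t)
    (hg_cont : ∀ t ∈ Icc 0 T, ContinuousOn (fun y => g y t) Ω)
    (hg_bound : ∃ m : ℝ → ℝ, (∀ t ∈ Icc 0 T, 0 ≤ m t) ∧
      KSIntegrable m (fun t => varFrom h 0 t) 0 T ∧
      ∀ y ∈ Ω, ∀ t ∈ Icc 0 T, norm1 (g y t) ≤ m t)
    (lam : ℝ) (hlam : lam ∈ Λ) (x : ℝ → Vec n) (hx : IsRegulatedOn x 0 T) :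
    (IsSIESolution T Ω f g h lam x ↔
      IsMDESolution T Ω f g h lam x ∧
        ∃ d : ℝ, HasRightJump h 0 d ∧ HasRightJump x 0 (d • g (x 0) 0)) ∧
    (IsMDESolution T Ω f g h lam x →
      ∀ s t : ℝ, 0 < s → s ≤ t → t ≤ T → StieltjesEquationAt f g h lam x s t) := by
  obtain ⟨m, -, hm, hfm⟩ := hf_bound
  obtain ⟨m', -, hm', hgm⟩ := hg_bound
  refine ⟨⟨fun H => H.isMDESolution hT hh_left hh_bv (hf_cont lam hlam) (hf_meas lam hlam) hm
    (hfm lam hlam) hm' hgm, ?_⟩, fun H s t hs hst ht => H.stieltjesEquationAt hT hh_left hs hst ht⟩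
  rintro ⟨H, d, hd, hxd⟩
  exact H.isSIESolution hT hh_left hd hxd
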